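/- Let $\mathcal{H}$ be a complex Hilbert space, let $m$ and $N_1,\dots,N_m$ be natural numbers, and for $p=1,\dots,m$ and $i=1,\dots,N_p$ let $\mathcal{K}_{p,i}$ be a complex Hilbert space and $A_{p,i}:\mathcal{K}_{p,i}\to\mathcal{H}$ a bounded linear operator. Suppose that $A_{p,i}^*A_{q,j}:\mathcal{K}_{q,j}\to\mathcal{K}_{p,i}$ is compact for all $p\neq q$, $i=1,\dots,N_p$ and $j=1,\dots,N_q$. If for every $p=1,\dots,m$ the set $$\mathcal{R}_p=\sum_{i=1}^{N_p}\operatorname{Ran}(A_{p,i})=\Big\{\sum_{i=1}^{N_p}A_{p,i}x_i \;\Big|\; x_i\in\mathcal{K}_{p,i}\Big\}$$ is closed in $\mathcal{H}$, then $$\sum_{p=1}^m\mathcal{R}_p=\Big\{\sum_{p=1}^m y_p \;\Big|\; y_p\in\mathcal{R}_p\Big\}$$ is closed in $\mathcal{H}$. -/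

import Mathlib

open scoped Pointwise

/-! Merge the operators `A p i` with a common `p` into one row operator `T p` with range `R p`, and
let `V p` be the inclusion of `R p` into `H`. As `R p` is closed, the open mapping theorem gives
`V p = T p ∘ G p` with `G p` bounded, so `(V p)† ∘ V q = (G p)† ∘ ((T p)† ∘ T q) ∘ G q` is compact
for `p ≠ q`. Since each `V p` is an isometry, the row `S` of all the `V p` satisfies
`S† ∘ S = 1 + compact`. This persists on the orthogonal complement of `ker S`, where `S` is
injective; there the Fredholm alternative makes `S† ∘ S` invertible, so `S` has a bounded left
inverse and its range, which is `∑ p, R p`, is closed. -/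

open ContinuousLinearMap
open scoped InnerProduct

section RowOperator

variable {R ι H : Type*} [Semiring R] [Fintype ι] {K : ι → Type*}
  [∀ i, NormedAddCommGroup (K i)] [∀ i, Module R (K i)]
  [AddCommMonoid H] [Module R H] [TopologicalSpace H] [ContinuousAdd H]

/-- The operator `x ↦ ∑ i, A i (x i)` on the `ℓ²`-sum of the domains of the operators `A i`, that
is, the block matrix with the single row `(A i)ᵢ`. The `ℓ²`-norm is used so that the domain is a
Hilbert space when every `K i` is one. -/
noncomputable def rowOperator (A : ∀ i, K i →L[R] H) : PiLp 2 K →L[R] H :=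
  ∑ i, A i ∘L PiLp.proj 2 K i

theorem range_rowOperator (A : ∀ i, K i →L[R] H) :
    Set.range (rowOperator A) = ∑ i, Set.range (A i) := by
  ext y
  rw [Set.mem_fintype_sum]
  constructor
  · rintro ⟨x, rfl⟩
    exact ⟨fun i => A i (x i), fun i => ⟨x i, rfl⟩, by simp [rowOperator]⟩
  · rintro ⟨g, hg, rfl⟩
    choose x hx using hg
    exact ⟨WithLp.toLp 2 x, by simp [rowOperator, hx]⟩

end RowOperator

section Compact

variable {𝕜 E E' F F' : Type*}

theorem isCompactOperator_sum [Semiring 𝕜]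
    [AddCommMonoid E] [Module 𝕜 E] [TopologicalSpace E]
    [AddCommMonoid F] [Module 𝕜 F] [TopologicalSpace F] [ContinuousAdd F]
    {ι : Type*} {s : Finset ι} {T : ι → E →L[𝕜] F}
    (hT : ∀ i ∈ s, IsCompactOperator (T i)) : IsCompactOperator (∑ i ∈ s, T i : E →L[𝕜] F) :=
  Finset.sum_induction T (fun f => IsCompactOperator f) (fun _ _ => IsCompactOperator.add)
    isCompactOperator_zero hT

theorem isCompactOperator_comp_comp [Semiring 𝕜]
    [AddCommMonoid E] [Module 𝕜 E] [TopologicalSpace E]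
    [AddCommMonoid E'] [Module 𝕜 E'] [TopologicalSpace E']
    [AddCommMonoid F] [Module 𝕜 F] [TopologicalSpace F]
    [AddCommMonoid F'] [Module 𝕜 F'] [TopologicalSpace F']
    {T : E →L[𝕜] F} (hT : IsCompactOperator T) (L : F →L[𝕜] F') (R : E' →L[𝕜] E) :
    IsCompactOperator (L ∘L T ∘L R) :=
  (hT.comp_clm R).clm_comp L

end Compact

section RCLike

variable {𝕜 : Type*} [RCLike 𝕜]

section Hilbert

variable {E F : Type*} [NormedAddCommGroup E] [InnerProductSpace 𝕜 E]

theorem adjoint_subtypeL_comp_subtypeL (U : Submodule 𝕜 E) [CompleteSpace E] [CompleteSpace U] :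
    U.subtypeL† ∘L U.subtypeL = 1 := by
  rw [U.adjoint_subtypeL]
  ext1 x
  exact U.orthogonalProjectionOnto_mem_subspace_eq_self x

theorem injective_comp_subtypeL_ker_orthogonal [NormedAddCommGroup F] [NormedSpace 𝕜 F]
    (T : E →L[𝕜] F) : Function.Injective (T ∘L T.kerᗮ.subtypeL) := by
  refine (injective_iff_map_eq_zero _).2 fun x hx => ?_
  exact Subtype.ext (T.ker.orthogonal_disjoint.le_bot ⟨hx, x.2⟩)

variable [CompleteSpace E]

theorem range_comp_subtypeL_ker_orthogonal [NormedAddCommGroup F] [NormedSpace 𝕜 F]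
    (T : E →L[𝕜] F) : Set.range (T ∘L T.kerᗮ.subtypeL) = Set.range T := by
  have : CompleteSpace T.ker := T.isClosed_ker.completeSpace_coe
  refine Set.Subset.antisymm (Set.range_comp_subset_range T.kerᗮ.subtypeL T) ?_
  rintro _ ⟨x, rfl⟩
  have hx : T (T.ker.starProjection x) = 0 := T.ker.starProjection_apply_mem x
  exact ⟨⟨x - T.ker.starProjection x, T.ker.sub_starProjection_mem_orthogonal x⟩, by simp [hx]⟩

theorem exists_comp_eq_subtypeL_range [NormedAddCommGroup F] [NormedSpace 𝕜 F] [CompleteSpace F]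
    (T : E →L[𝕜] F) [CompleteSpace T.range] :
    ∃ G : T.range →L[𝕜] E, T ∘L G = T.range.subtypeL := by
  have hclosed : IsClosed (Set.range T) :=
    (completeSpace_coe_iff_isComplete.1 ‹CompleteSpace T.range›).isClosed
  set T₀ := T ∘L T.kerᗮ.subtypeL
  have hrange : Set.range T₀ = Set.range T := range_comp_subtypeL_ker_orthogonal T
  let e := T₀.equivRange (injective_comp_subtypeL_ker_orthogonal T) (hrange ▸ hclosed)
  have hle : T.range ≤ T₀.range := hrange.ge
  refine ⟨T.kerᗮ.subtypeL ∘L e.symm ∘L T.range.subtypeL.codRestrict T₀.range fun y => hle y.2, ?_⟩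
  ext y
  exact congrArg Subtype.val (e.apply_symm_apply ⟨y, hle y.2⟩)

variable [NormedAddCommGroup F] [InnerProductSpace 𝕜 F] [CompleteSpace F]

theorem hasLeftInverse_of_isCompactOperator_adjoint_comp_self_sub_id (S : E →L[𝕜] F)
    (hinj : Function.Injective S) (hS : IsCompactOperator (S† ∘L S - 1 : E →L[𝕜] E)) :
    S.HasLeftInverse := by
  have hnot : ¬ Module.End.HasEigenvalue ((S† ∘L S - 1 : E →L[𝕜] E) : Module.End 𝕜 E) (-1) := by
    intro h
    obtain ⟨x, hx⟩ := h.exists_hasEigenvector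
    have hker : (S†) (S x) = 0 := by simpa using hx.apply_eq_smul
    exact hx.2 (S.adjoint_comp_self_injective_iff.2 hinj (by simpa using hker))
  have hunit : IsUnit (S† ∘L S) := by
    have := (hS.hasEigenvalue_or_mem_resolventSet (neg_ne_zero.2 one_ne_zero)).resolve_left hnot
    simpa using IsUnit.sub_iff.1 this
  obtain ⟨R, hR⟩ := hunit.exists_left_inv
  exact ⟨R ∘L S†, DFunLike.congr_fun hR⟩

theorem isClosed_range_of_isCompactOperator_adjoint_comp_self_sub_id (S : E →L[𝕜] F)
    (hS : IsCompactOperator (S† ∘L S - 1 : E →L[𝕜] E)) : IsClosed (Set.range S) := by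
  set V := S.kerᗮ
  set S₀ := S ∘L V.subtypeL
  have hS₀ : S₀† ∘L S₀ - 1 = V.subtypeL† ∘L (S† ∘L S - 1 : E →L[𝕜] E) ∘L V.subtypeL := by
    rw [← adjoint_subtypeL_comp_subtypeL V, adjoint_comp, sub_comp, comp_sub, one_def, id_comp]
    simp only [S₀, comp_assoc]
  rw [← range_comp_subtypeL_ker_orthogonal S]
  refine (hasLeftInverse_of_isCompactOperator_adjoint_comp_self_sub_id S₀
    (injective_comp_subtypeL_ker_orthogonal S) ?_).isClosed_range
  rw [hS₀]
  exact isCompactOperator_comp_comp hS _ _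

theorem isCompactOperator_adjoint_comp_subtypeL_range {E' : Type*} [NormedAddCommGroup E']
    [InnerProductSpace 𝕜 E'] [CompleteSpace E'] (T : E →L[𝕜] F) (T' : E' →L[𝕜] F)
    [CompleteSpace T.range] [CompleteSpace T'.range] (h : IsCompactOperator (T† ∘L T')) :
    IsCompactOperator (T.range.subtypeL† ∘L T'.range.subtypeL) := by
  obtain ⟨G, hG⟩ := exists_comp_eq_subtypeL_range T
  obtain ⟨G', hG'⟩ := exists_comp_eq_subtypeL_range T'
  rw [← hG, ← hG', adjoint_comp]
  exact isCompactOperator_comp_comp h (G†) G'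

end Hilbert

section Sum

variable {ι H : Type*} [Fintype ι] [NormedAddCommGroup H] [InnerProductSpace 𝕜 H] [CompleteSpace H]
  {K : ι → Type*} [∀ i, NormedAddCommGroup (K i)] [∀ i, InnerProductSpace 𝕜 (K i)]
  [∀ i, CompleteSpace (K i)]

theorem adjoint_rowOperator_comp_rowOperator {κ : Type*} [Fintype κ] {L : κ → Type*}
    [∀ j, NormedAddCommGroup (L j)] [∀ j, InnerProductSpace 𝕜 (L j)] [∀ j, CompleteSpace (L j)]
    (A : ∀ i, K i →L[𝕜] H) (B : ∀ j, L j →L[𝕜] H) :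
    (rowOperator A)† ∘L rowOperator B =
      ∑ i, ∑ j, (PiLp.proj 2 K i)† ∘L ((A i)† ∘L B j) ∘L PiLp.proj 2 L j := by
  simp only [rowOperator, map_sum, adjoint_comp, finsetSum_comp, comp_finsetSum, comp_assoc]
  exact Finset.sum_comm

theorem isCompactOperator_adjoint_rowOperator_comp_rowOperator {κ : Type*} [Fintype κ]
    {L : κ → Type*} [∀ j, NormedAddCommGroup (L j)] [∀ j, InnerProductSpace 𝕜 (L j)]
    [∀ j, CompleteSpace (L j)] {A : ∀ i, K i →L[𝕜] H} {B : ∀ j, L j →L[𝕜] H}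
    (h : ∀ i j, IsCompactOperator ((A i)† ∘L B j)) :
    IsCompactOperator ((rowOperator A)† ∘L rowOperator B) := by
  rw [adjoint_rowOperator_comp_rowOperator]
  exact isCompactOperator_sum fun i _ => isCompactOperator_sum fun j _ =>
    isCompactOperator_comp_comp (h i j) _ _

variable (K) in
theorem sum_adjoint_proj_comp_proj :
    (∑ i, (PiLp.proj 2 K i)† ∘L PiLp.proj 2 K i : PiLp 2 K →L[𝕜] PiLp 2 K) = 1 := by
  ext1 x
  refine ext_inner_right 𝕜 fun y => ?_
  simp [sum_inner, adjoint_inner_left, PiLp.inner_apply]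

theorem isCompactOperator_adjoint_rowOperator_comp_self_sub_id {V : ∀ i, K i →L[𝕜] H}
    (hV : ∀ i, (V i)† ∘L V i = 1)
    (hcompact : ∀ i j, i ≠ j → IsCompactOperator ((V i)† ∘L V j)) :
    IsCompactOperator
      ((rowOperator V)† ∘L rowOperator V - 1 : PiLp 2 K →L[𝕜] PiLp 2 K) := by
  classical
  have hoff : (rowOperator V)† ∘L rowOperator V - 1 =
      ∑ i, ∑ j ∈ Finset.univ.erase i,
        (PiLp.proj 2 K i)† ∘L ((V i)† ∘L V j) ∘L PiLp.proj 2 K j := by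
    rw [adjoint_rowOperator_comp_rowOperator, ← sum_adjoint_proj_comp_proj K,
      ← Finset.sum_sub_distrib]
    refine Finset.sum_congr rfl fun i _ => ?_
    rw [← Finset.add_sum_erase _ _ (Finset.mem_univ i), hV, one_def, id_comp, add_sub_cancel_left]
  rw [hoff]
  exact isCompactOperator_sum fun i _ => isCompactOperator_sum fun j hj =>
    isCompactOperator_comp_comp (hcompact i j (Finset.ne_of_mem_erase hj).symm) _ _

theorem isClosed_sum_range_of_isCompactOperator {T : ∀ i, K i →L[𝕜] H}
    (hcompact : ∀ i j, i ≠ j → IsCompactOperator ((T i)† ∘L T j))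
    (hclosed : ∀ i, IsClosed (Set.range (T i))) : IsClosed (∑ i, Set.range (T i)) := by
  have (i : ι) : CompleteSpace (T i).range := (hclosed i).completeSpace_coe
  let V (i : ι) : (T i).range →L[𝕜] H := (T i).range.subtypeL
  have hrange (i : ι) : Set.range (T i) = Set.range (V i) := Subtype.range_coe.symm
  have hisometry (i : ι) : (V i)† ∘L V i = 1 := adjoint_subtypeL_comp_subtypeL _
  simp only [hrange]
  rw [← range_rowOperator]
  exact isClosed_range_of_isCompactOperator_adjoint_comp_self_sub_id _ <|
    isCompactOperator_adjoint_rowOperator_comp_self_sub_id hisometry fun i j hij =>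
      isCompactOperator_adjoint_comp_subtypeL_range _ _ (hcompact i j hij)

theorem theorem1p2_general {N : ι → Type*} [∀ p, Fintype (N p)] {K : ∀ p, N p → Type*}
    [∀ p i, NormedAddCommGroup (K p i)] [∀ p i, InnerProductSpace 𝕜 (K p i)]
    [∀ p i, CompleteSpace (K p i)] (A : ∀ p i, K p i →L[𝕜] H)
    (hcompact : ∀ p q, p ≠ q → ∀ i j, IsCompactOperator ((A p i)† ∘L A q j))
    (hclosed : ∀ p, IsClosed (∑ i, Set.range (A p i))) :
    IsClosed (∑ p, ∑ i, Set.range (A p i)) := by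
  simp only [← range_rowOperator] at hclosed ⊢
  rw [range_rowOperator]
  exact isClosed_sum_range_of_isCompactOperator
    (fun p q hpq => isCompactOperator_adjoint_rowOperator_comp_rowOperator (hcompact p q hpq))
    hclosed

end Sum

end RCLike

theorem theorem1p2 {H : Type*} [NormedAddCommGroup H] [InnerProductSpace ℂ H] [CompleteSpace H]
    (m : ℕ) (N : Fin m → ℕ) (K : (p : Fin m) → Fin (N p) → Type*)
    [∀ p i, NormedAddCommGroup (K p i)] [∀ p i, InnerProductSpace ℂ (K p i)]
    [∀ p i, CompleteSpace (K p i)]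
    (A : (p : Fin m) → (i : Fin (N p)) → K p i →L[ℂ] H)
    (hcompact : ∀ (p q : Fin m), p ≠ q → ∀ (i : Fin (N p)) (j : Fin (N q)),
      IsCompactOperator ((ContinuousLinearMap.adjoint (A p i)) ∘L (A q j)))
    (hclosed : ∀ p : Fin m, IsClosed (∑ i : Fin (N p), Set.range (A p i) : Set H)) :
    IsClosed (∑ p : Fin m, ∑ i : Fin (N p), Set.range (A p i) : Set H) :=
  theorem1p2_general A hcompact hclosed
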